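/- Let $\mathbb K$ be $\mathbb R$ or $\mathbb C$. Let $r=(r_n)$, $s=(s_n)$, $t=(t_n)$, $n\ge 0$, be sequences in $\mathbb K$ with $r_n\ne0$, $t_n\neq 0$ for all $n$ and $s_0\ne 0$, and let $u,v\in\mathbb K\setminus\{0\}$. For a sequence $x=(x_k)_{k\ge0}$ put $(Bx)_0=ux_0$, $(Bx)_n=vx_{n-1}+ux_n$ $(n\ge1)$, and $$(Tx)_n=\frac1{r_n}\sum_{k=0}^n s_{n-k}t_k(Bx)_k .$$ Let $l_1(r,s,t;B)=\{x: Tx\in l_1\}$ with the norm $\|x\|=\|Tx\|_{l_1}$. Put $$D_n=\frac{1}{s_0^{n+1}}\det\big(\sigma_{ij}\big)_{0\le i,j<n},\qquad \sigma_{ij}=s_{i+1-j}\text{ if } j\le i+1,\quad \sigma_{ij}=0\text{ otherwise}$$ (so $D_0=1/s_0$). Let $1\le p<\infty$ and let $A=(a_{nk})_{n,k\ge0}$ be an infinite matrix over $\mathbb K$ in the class $(l_1(r,s,t;B),l_p)$, i.e. for every $x\in l_1(r,s,t;B)$ all the series $(Ax)_n=\sum_{k=0}^\infty a_{nk}x_k$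 converge and $Ax\in l_p$. Then the following hold. (i) For all $n,k$ the limit $$\tilde a_{nk}=\lim_{N\to\infty} r_k\Big[\frac{a_{nk}}{s_0t_k}\frac1u+\sum_{i=k}^{k+1}(-1)^{i-k}\frac{D_{i-k}}{t_i}\sum_{j=k+1}^{N}\frac{(-v)^{j-i}}{u^{j-i+1}}a_{nj}+\sum_{i=k+2}^{N}(-1)^{i-k}\frac{D_{i-k}}{t_i}\sum_{j=i}^{N}\frac{(-v)^{j-i}}{u^{j-i+1}}a_{nj}\Big]$$ exists. If for some $n,k$ the double series $\sum_{i\ge k}\sum_{j\ge i}\frac{D_{i-k}}{t_i}\frac{(-v)^{j-i}}{u^{j-i+1}}a_{nj}$ converges absolutely, then $\tilde a_{nk}$ equals the same expression with each upper limit $N$ replaced by $\infty$ (iterated series). (ii) $L_A(x)=Ax$ defines a bounded linear operator $L_A: l_1(r,s,t;B)\to l_p$. (iii) $\sup_k\big(\sum_{n>m}|\tilde a_{nk}|^p\big)^{1/p}<\infty$ for all $m\ge0$, and $$\|L_A\|_\chi=\chi\big(L_A(S)\big)=\lim_{m\to\infty}\ \sup_{k\ge0}\Big(\sum_{n=m+1}^\infty|\tilde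 a_{nk}|^p\Big)^{1/p},$$ where $S=\{x\in l_1(r,s,t;B):\|x\|=1\}$. Here, for a bounded subset $Q$ of a metric space, $\chi(Q)$ is the infimum of all $\varepsilon>0$ such that $Q$ is covered by finitely many open balls of radii less than $\varepsilon$, and, for a bounded linear operator $L$ between normed spaces, $\|L\|_\chi$ is the infimum of all $\kappa\ge0$ such that $\chi(L(Q))\le\kappa\,\chi(Q)$ for all bounded sets $Q$. -/

import Mathlib

open Filter Topology
open scoped ENNReal

noncomputable section

/-- Parameters of the space: `r, t` are nowhere zero sequences, `s` is a sequence with `s 0 ≠ 0`,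
and `u, v` are nonzero scalars. -/
structure GenMeanData (𝕜 : Type*) [RCLike 𝕜] where
  r : ℕ → 𝕜
  s : ℕ → 𝕜
  t : ℕ → 𝕜
  u : 𝕜
  v : 𝕜
  r_ne : ∀ n, r n ≠ 0
  t_ne : ∀ n, t n ≠ 0
  s_ne : s 0 ≠ 0
  u_ne : u ≠ 0
  v_ne : v ≠ 0

namespace GenMeanData

variable {𝕜 : Type*} [RCLike 𝕜] (P : GenMeanData 𝕜)

/-- The `B(u,v)`-transform: `(Bx)_0 = u x_0` and `(Bx)_n = v x_{n-1} + u x_n` for `n ≥ 1`. -/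
def diffB (x : ℕ → 𝕜) : ℕ → 𝕜
  | 0 => P.u * x 0
  | n + 1 => P.v * x n + P.u * x (n + 1)

/-- Generalized means: `(A(r,s,t) z)_n = (1/r_n) ∑_{k=0}^n s_{n-k} t_k z_k`. -/
def genMean (z : ℕ → 𝕜) (n : ℕ) : 𝕜 :=
  1 / P.r n * ∑ k ∈ Finset.range (n + 1), P.s (n - k) * P.t k * z k

/-- The triangle `A(r,s,t;B) = A(r,s,t) · B(u,v)` as a linear map on the space of all sequences. -/
def T : (ℕ → 𝕜) →ₗ[𝕜] (ℕ → 𝕜) where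
  toFun x := P.genMean (P.diffB x)
  map_add' x y := by
    have h : P.diffB (x + y) = P.diffB x + P.diffB y := by
      funext n
      cases n <;> simp only [diffB, Pi.add_apply] <;> ring
    funext n
    simp only [h, genMean, Pi.add_apply, mul_add, Finset.sum_add_distrib]
  map_smul' c x := by
    have h : P.diffB (c • x) = c • P.diffB x := by
      funext n
      cases n <;> simp only [diffB, Pi.smul_apply, smul_eq_mul] <;> ring
    funext n
    simp only [h, genMean, Pi.smul_apply, smul_eq_mul, RingHom.id_apply, Finset.mul_sum]
    exact Finset.sum_congr rfl fun k _ => by ring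

theorem T_injective : Function.Injective P.T := by
  rw [← LinearMap.ker_eq_bot, LinearMap.ker_eq_bot']
  intro x hx
  have hz : ∀ n, P.diffB x n = 0 := by
    intro n
    induction n using Nat.strong_induction_on with
    | _ n ih =>
      have h : P.genMean (P.diffB x) n = 0 := congrFun hx n
      rw [genMean, Finset.sum_range_succ, Finset.sum_eq_zero (fun k hk => by
        rw [ih k (Finset.mem_range.1 hk), mul_zero])] at h
      simpa [P.r_ne n, P.t_ne n, P.s_ne] using h
  funext n
  induction n with
  | zero => simpa [diffB, P.u_ne] using hz 0
  | succ n ih =>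
    have h := hz (n + 1)
    simp only [Pi.zero_apply] at ih
    simpa [diffB, P.u_ne, ih] using h

/-- The set of sequences `l_p(r,s,t;B) = {x : A(r,s,t;B) x ∈ l_p}`, as a linear subspace. -/
def seqSubmodule (p : ℝ≥0∞) : Submodule 𝕜 (ℕ → 𝕜) where
  carrier := {x | Memℓp (P.T x) p}
  add_mem' {x y} hx hy := by
    simp only [Set.mem_ofPred_eq, map_add] at *
    exact hx.add hy
  zero_mem' := by
    simp only [Set.mem_ofPred_eq, map_zero]
    exact zero_memℓp
  smul_mem' c x hx := by
    simp only [Set.mem_ofPred_eq, map_smul] at *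
    exact hx.const_smul c

/-- The space `l_p(r,s,t;B)` as a type of its own, so that its topology is the one of the norm
below and not that of coordinatewise convergence. -/
def Space (p : ℝ≥0∞) : Type _ := ↥(P.seqSubmodule p)

instance (p : ℝ≥0∞) : AddCommGroup (P.Space p) :=
  inferInstanceAs (AddCommGroup ↥(P.seqSubmodule p))

instance (p : ℝ≥0∞) : Module 𝕜 (P.Space p) :=
  inferInstanceAs (Module 𝕜 ↥(P.seqSubmodule p))

/-- The underlying sequence of an element of `l_p(r,s,t;B)`. -/
def Space.seq {P : GenMeanData 𝕜} {p : ℝ≥0∞} (x : P.Space p) : ℕ → 𝕜 := Subtype.val x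

/-- The map `x ↦ A(r,s,t;B) x` from `l_p(r,s,t;B)` to `l_p`. -/
def toLp (p : ℝ≥0∞) : P.Space p →ₗ[𝕜] lp (fun _ : ℕ => 𝕜) p where
  toFun x := ⟨P.T x.seq, x.2⟩
  map_add' x y := by
    ext1
    exact map_add P.T x.seq y.seq
  map_smul' c x := by
    ext1
    exact map_smul P.T c x.seq

theorem toLp_injective (p : ℝ≥0∞) : Function.Injective (P.toLp p) := by
  intro x y h
  have h' : P.T x.seq = P.T y.seq := congrArg Subtype.val h
  exact Subtype.ext (P.T_injective h')

/-- The norm `‖x‖ = ‖A(r,s,t;B) x‖_{l_p}`. -/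
instance (p : ℝ≥0∞) [Fact (1 ≤ p)] : NormedAddCommGroup (P.Space p) :=
  NormedAddCommGroup.induced (P.Space p) (lp (fun _ : ℕ => 𝕜) p) (P.toLp p) (P.toLp_injective p)

instance (p : ℝ≥0∞) [Fact (1 ≤ p)] : NormedSpace 𝕜 (P.Space p) :=
  NormedSpace.induced 𝕜 (P.Space p) (lp (fun _ : ℕ => 𝕜) p) (P.toLp p)

/-- `D_n^{(s)} = s_0^{-(n+1)} det M_n`, where `M_n` is the `n × n` matrix whose entry in row `i`,
column `j` (counted from `0`) is `s_{i+1-j}` for `j ≤ i + 1` and `0` otherwise.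
In particular `D_0^{(s)} = 1 / s_0`. -/
def D (n : ℕ) : 𝕜 :=
  1 / P.s 0 ^ (n + 1) *
    (Matrix.of fun i j : Fin n =>
      if (j : ℕ) ≤ (i : ℕ) + 1 then P.s ((i : ℕ) + 1 - (j : ℕ)) else 0).det

/-- The expression defining the `k`-th entry of the sequence associated with `a`, with the upper
limits `∞` of all sums replaced by `N`. -/
def tildeSection (a : ℕ → 𝕜) (k N : ℕ) : 𝕜 :=
  P.r k *
    (a k / (P.s 0 * P.t k) * (1 / P.u)
      + ∑ i ∈ Finset.Icc k (k + 1), (-1) ^ (i - k) * (P.D (i - k) / P.t i) *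
          ∑ j ∈ Finset.Icc (k + 1) N, (-P.v) ^ (j - i) / P.u ^ (j - i + 1) * a j
      + ∑ i ∈ Finset.Icc (k + 2) N, (-1) ^ (i - k) * (P.D (i - k) / P.t i) *
          ∑ j ∈ Finset.Icc i N, (-P.v) ^ (j - i) / P.u ^ (j - i + 1) * a j)

/-- The same expression with iterated infinite series. The summation indices are
`j = k + 1 + m` in the first series, and `i = k + 2 + l`, `j = i + m` in the iterated one. -/
def tildeSeries (a : ℕ → 𝕜) (k : ℕ) : 𝕜 :=
  P.r k *
    (a k / (P.s 0 * P.t k) * (1 / P.u)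
      + ∑ i ∈ Finset.Icc k (k + 1), (-1) ^ (i - k) * (P.D (i - k) / P.t i) *
          ∑' m : ℕ, (-P.v) ^ (k + 1 + m - i) / P.u ^ (k + 1 + m - i + 1) * a (k + 1 + m)
      + ∑' l : ℕ, (-1) ^ (l + 2) * (P.D (l + 2) / P.t (k + 2 + l)) *
          ∑' m : ℕ, (-P.v) ^ m / P.u ^ (m + 1) * a (k + 2 + l + m))

/-- Absolute convergence of the double series over `k ≤ i ≤ j` (with `i = k + q.1` and
`j = i + q.2`) behind the expression above. -/
def TildeAbsConv (a : ℕ → 𝕜) (k : ℕ) : Prop :=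
  Summable fun q : ℕ × ℕ =>
    ‖P.D q.1 / P.t (k + q.1) * ((-P.v) ^ q.2 / P.u ^ (q.2 + 1) * a (k + q.1 + q.2))‖

/-- The matrix `Ã`: the entry `ã_{nk}` is the limit of the sections of the defining expression,
formed with the `n`-th row of `A`. -/
def tilde (A : ℕ → ℕ → 𝕜) (n k : ℕ) : 𝕜 :=
  limUnder atTop (P.tildeSection (A n) k)

end GenMeanData

/-- `y = Ax`: for each `n` the series `∑_k a_{nk} x_k` converges (as the limit of its partial sums)
and has the sum `y_n`. -/
def IsMatrixTransform {𝕜 : Type*} [RCLike 𝕜] (A : ℕ → ℕ → 𝕜) (x y : ℕ → 𝕜) : Prop :=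
  ∀ n, Tendsto (fun N => ∑ k ∈ Finset.range N, A n k * x k) atTop (𝓝 (y n))

/-- The class `(U, V)` of infinite matrices: `Ax` exists and lies in `V` for all `x ∈ U`. -/
def MatrixClass {𝕜 : Type*} [RCLike 𝕜] (U V : Set (ℕ → 𝕜)) : Set (ℕ → ℕ → 𝕜) :=
  {A | ∀ x ∈ U, ∃ y ∈ V, IsMatrixTransform A x y}

/-- The Hausdorff measure of noncompactness of a bounded set `Q`: the infimum of all `ε > 0` such
that `Q` is covered by finitely many open balls with radii less than `ε`. -/
def hausdorffMNC {X : Type*} [PseudoMetricSpace X] (Q : Set X) : ℝ :=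
  sInf {ε : ℝ | 0 < ε ∧ ∃ (n : ℕ) (x : Fin (n + 1) → X) (ρ : Fin (n + 1) → ℝ),
    (∀ i, 0 < ρ i ∧ ρ i < ε) ∧ Q ⊆ ⋃ i, Metric.ball (x i) (ρ i)}

/-- The Hausdorff measure of noncompactness `‖L‖_χ` of an operator: the least `κ ≥ 0` with
`χ(L(Q)) ≤ κ χ(Q)` for all bounded sets `Q`. -/
def operatorMNC {X Y : Type*} [PseudoMetricSpace X] [PseudoMetricSpace Y] (L : X → Y) : ℝ :=
  sInf {κ : ℝ | 0 ≤ κ ∧ ∀ Q : Set X, Bornology.IsBounded Q →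
    Bornology.IsBounded (L '' Q) ∧ hausdorffMNC (L '' Q) ≤ κ * hausdorffMNC Q}

/-- `sup_k (∑_{n > m} |c_{nk}|^p)^{1/p}`, with values in `[0, ∞]`. -/
def columnTailSup {𝕜 : Type*} [RCLike 𝕜] (p : ℝ≥0∞) (C : ℕ → ℕ → 𝕜) (m : ℕ) : ℝ≥0∞ :=
  ⨆ k : ℕ, (∑' n : ℕ, ‖C (m + 1 + n) k‖ₑ ^ p.toReal) ^ (1 / p.toReal)

end

/-! The map `T` is an isometry of the domain onto `l_1`, so everything is governed by the vectors
`T⁻¹ e_k`. Inverting the mean amounts to inverting the power series of `s`; Cramer's rule turns its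
coefficients into `(-1)^n D_n` (`invCoeff_eq`), and `B⁻¹` contributes the powers of `-v/u`. The
sections defining `ã_{nk}` are, for large `N`, partial sums of `(Ax)_n` at `x = T⁻¹ e_k`
(`tildeSection_eq_sum_basis`). Hence they converge, and column `k` of `Ã` is the image of `T⁻¹ e_k`
under `A`.

Boundedness of the operator `L` follows from Banach-Steinhaus and the closed graph theorem
(`exists_continuousLinearMap`). A bound at the unit vectors of `l_1` is a bound on the operator
norm, so the column tail suprema are the norms of `L` followed by removal of the coordinates `0, …,
m`; they decrease to a limit `c`. The removed part has finite rank, which gives `χ(L(Q)) ≤ c χ(Q)`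
(`hausdorffMNC_image_le_mul`). Conversely, tails of finitely many centres vanish in the limit, so
`χ(L(S))` dominates `c` (`exists_forall_norm_lpTail_le`). -/

namespace GenMeanData

variable {𝕜 : Type*} [RCLike 𝕜] (P : GenMeanData 𝕜)

/-! ### Inversion of the triangle `T`. -/

/-- The coefficients of the inverse of the power series with coefficients `s`. -/
noncomputable def invCoeff (n : ℕ) : 𝕜 := PowerSeries.coeff n (PowerSeries.mk P.s)⁻¹

theorem sum_s_mul_invCoeff (n : ℕ) :
    ∑ i ∈ Finset.range (n + 1), P.s (n - i) * P.invCoeff i = if n = 0 then 1 else 0 := by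
  have h : (PowerSeries.mk P.s)⁻¹ * PowerSeries.mk P.s = 1 :=
    PowerSeries.inv_mul_cancel _ (by simpa using P.s_ne)
  have h2 := congrArg (PowerSeries.coeff n) h
  rw [PowerSeries.coeff_mul, PowerSeries.coeff_one,
    Finset.Nat.sum_antidiagonal_eq_sum_range_succ_mk] at h2
  rw [← h2]
  refine Finset.sum_congr rfl fun i _ => ?_
  simp [invCoeff, mul_comm]

/-- The lower triangular Toeplitz matrix with entries `s (i - j)`. -/
noncomputable def toeplitz (n : ℕ) : Matrix (Fin n) (Fin n) 𝕜 :=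
  Matrix.of fun i j => if (j : ℕ) ≤ i then P.s ((i : ℕ) - j) else 0

theorem det_toeplitz (n : ℕ) : (P.toeplitz n).det = P.s 0 ^ n := by
  rw [Matrix.det_of_isLowerTriangular]
  · simp [toeplitz]
  · intro i j hij
    have : (i : ℕ) < j := by simpa using hij
    simp [toeplitz, not_le.2 (show i < j from this)]

theorem toeplitz_mulVec_invCoeff (n : ℕ) :
    (P.toeplitz (n + 1)).mulVec (fun j => P.invCoeff j) = Pi.single 0 1 := by
  funext i
  have h : ∀ j : Fin (n + 1), P.toeplitz (n + 1) i j * P.invCoeff j =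
      (fun j : ℕ => if j ≤ i then P.s (i - j) * P.invCoeff j else 0) j := by
    intro j
    rw [toeplitz, Matrix.of_apply, ite_mul, zero_mul]
  rw [Matrix.mulVec, dotProduct, Finset.sum_congr rfl fun j _ => h j, Fin.sum_univ_eq_sum_range
    (fun j : ℕ => if j ≤ i then P.s (i - j) * P.invCoeff j else 0) (n + 1), ← Finset.sum_filter]
  have h2 : (Finset.range (n + 1)).filter (fun j => j ≤ (i : ℕ)) = Finset.range (i + 1) := by
    ext j
    have := i.2
    simp only [Finset.mem_filter, Finset.mem_range]
    omega
  rw [h2, sum_s_mul_invCoeff, Pi.single_apply]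
  simp only [Fin.ext_iff, Fin.val_zero]

/-- Cramer's rule for the triangular Toeplitz system with right-hand side `e_0`: deleting row `0`
and the last column leaves exactly the matrix in `D n`, and the cofactor sign is `(-1)^n`. -/
theorem invCoeff_eq (n : ℕ) : P.invCoeff n = (-1) ^ n * P.D n := by
  have h := congrFun (congrArg ((P.toeplitz (n + 1)).adjugate.mulVec)
    (P.toeplitz_mulVec_invCoeff n)) (Fin.last n)
  rw [Matrix.mulVec_mulVec, Matrix.adjugate_mul, det_toeplitz, Matrix.mulVec_single_one,
    Matrix.smul_mulVec, Matrix.one_mulVec, Matrix.col_apply,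
    Matrix.adjugate_fin_succ_eq_det_submatrix] at h
  have hm : (P.toeplitz (n + 1)).submatrix (Fin.succAbove 0) (Fin.succAbove (Fin.last n)) =
      Matrix.of fun i j : Fin n =>
        if (j : ℕ) ≤ (i : ℕ) + 1 then P.s ((i : ℕ) + 1 - (j : ℕ)) else 0 := by
    ext i j
    simp only [toeplitz, Matrix.submatrix_apply, Matrix.of_apply, Fin.zero_succAbove,
      Fin.succAbove_last, Fin.val_succ, Fin.val_castSucc]
  rw [hm] at h
  have hs : P.s 0 ^ (n + 1) ≠ 0 := pow_ne_zero _ P.s_ne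
  simp only [Pi.smul_apply, Fin.val_last, smul_eq_mul, Fin.val_zero, zero_add] at h
  rw [D]
  field_simp
  linear_combination h

/-- The `B`-transform of `T⁻¹ e_k`. -/
noncomputable def basisB (k j : ℕ) : 𝕜 := if k ≤ j then P.r k * P.invCoeff (j - k) / P.t j else 0

theorem genMean_basisB (k : ℕ) : P.genMean (P.basisB k) = Pi.single k 1 := by
  funext n
  have ht : ∀ j, P.s (n - j) * P.t j * P.basisB k j =
      if k ≤ j then P.r k * (P.s (n - j) * P.invCoeff (j - k)) else 0 := by
    intro j
    unfold basisB
    split_ifs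
    · have := P.t_ne j
      field_simp
    · simp
  simp only [genMean, ht]
  rcases lt_or_ge n k with h | h
  · rw [Finset.sum_eq_zero, mul_zero, Pi.single_eq_of_ne h.ne]
    intro j hj
    rw [if_neg]
    have := Finset.mem_range.1 hj
    omega
  · obtain ⟨l, rfl⟩ := Nat.exists_eq_add_of_le h
    rw [show k + l + 1 = k + (l + 1) by ring, Finset.sum_range_add, Finset.sum_eq_zero, zero_add]
    · have : ∀ i ∈ Finset.range (l + 1),
          (if k ≤ k + i then P.r k * (P.s (k + l - (k + i)) * P.invCoeff (k + i - k)) else 0) =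
          P.r k * (P.s (l - i) * P.invCoeff i) := by
        intro i _
        rw [if_pos (Nat.le_add_right _ _), Nat.add_sub_add_left, Nat.add_sub_cancel_left]
      rw [Finset.sum_congr rfl this, ← Finset.mul_sum, sum_s_mul_invCoeff]
      have := P.r_ne k
      rcases Nat.eq_zero_or_pos l with rfl | hl
      · simp only [if_true, mul_one, add_zero, Pi.single_eq_same]
        field_simp
      · rw [if_neg hl.ne', Pi.single_eq_of_ne (by omega)]
        simp
    · intro j hj
      rw [if_neg]
      have := Finset.mem_range.1 hj
      omega

/-- The sequence `B⁻¹ z`. -/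
noncomputable def invB (z : ℕ → 𝕜) (j : ℕ) : 𝕜 :=
  ∑ i ∈ Finset.range (j + 1), (-P.v) ^ (j - i) / P.u ^ (j - i + 1) * z i

theorem diffB_invB (z : ℕ → 𝕜) : P.diffB (P.invB z) = z := by
  have hu := P.u_ne
  funext n
  cases n with
  | zero => simp [diffB, invB, hu]
  | succ n =>
    simp only [diffB]
    conv_lhs => enter [2]; rw [invB, Finset.sum_range_succ]
    rw [invB, mul_add, ← add_assoc, Finset.mul_sum, Finset.mul_sum, ← Finset.sum_add_distrib,
      Finset.sum_eq_zero, zero_add]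
    · simp [hu]
    · intro i hi
      rw [show n + 1 - i = n - i + 1 by have := Finset.mem_range.1 hi; omega]
      field_simp
      ring

/-- The sequence `T⁻¹ e_k`. -/
noncomputable def basis (k : ℕ) : ℕ → 𝕜 := P.invB (P.basisB k)

theorem T_basis (k : ℕ) : P.T (P.basis k) = Pi.single k 1 := by
  change P.genMean (P.diffB (P.invB (P.basisB k))) = _
  rw [diffB_invB, genMean_basisB]

theorem basis_of_lt {k j : ℕ} (h : j < k) : P.basis k j = 0 := by
  rw [basis, invB, Finset.sum_eq_zero]
  intro i hi
  have := Finset.mem_range.1 hi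
  rw [basisB, if_neg (by omega), mul_zero]

theorem basis_add (k d : ℕ) : P.basis k (k + d) = P.r k * ∑ i ∈ Finset.range (d + 1),
    P.invCoeff i / P.t (k + i) * ((-P.v) ^ (d - i) / P.u ^ (d - i + 1)) := by
  rw [basis, invB, show k + d + 1 = k + (d + 1) by ring, Finset.sum_range_add,
    Finset.sum_eq_zero, zero_add, Finset.mul_sum]
  · refine Finset.sum_congr rfl fun i _ => ?_
    rw [basisB, if_pos (Nat.le_add_right _ _), Nat.add_sub_add_left, Nat.add_sub_cancel_left]
    ring
  · intro i hi
    have := Finset.mem_range.1 hi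
    rw [basisB, if_neg (by omega), mul_zero]

theorem T_congr {x y : ℕ → 𝕜} {n : ℕ} (h : ∀ j ≤ n, x j = y j) : P.T x n = P.T y n := by
  change 1 / P.r n * _ = 1 / P.r n * _
  congr 1
  refine Finset.sum_congr rfl fun k hk => ?_
  have hk := Finset.mem_range.1 hk
  congr 1
  cases k with
  | zero => simp only [diffB, h 0 (Nat.zero_le _)]
  | succ k => simp only [diffB, h k (by omega), h (k + 1) (by omega)]

/-- The sequence `T⁻¹ y`. -/
noncomputable def invT (y : ℕ → 𝕜) (j : ℕ) : 𝕜 := ∑ k ∈ Finset.range (j + 1), y k * P.basis k j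

/-- Coordinate `n` of `T` sees only the entries up to `n`, where `invT y` is a finite combination of
the `basis k`; so no convergence is involved. -/
theorem T_invT (y : ℕ → 𝕜) : P.T (P.invT y) = y := by
  funext n
  have h : ∀ j ≤ n, P.invT y j = (∑ k ∈ Finset.range (n + 1), y k • P.basis k) j := by
    intro j hj
    rw [invT, Finset.sum_apply]
    refine Finset.sum_subset (Finset.range_mono (by omega)) fun k _ hk => ?_
    rw [P.basis_of_lt (by simpa using hk), mul_zero]
  rw [P.T_congr h, map_sum, Finset.sum_apply, Finset.sum_eq_single n]
  · simp [T_basis]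
  · intro k _ hk
    simp [T_basis, hk.symm]
  · simp

theorem invT_T (x : ℕ → 𝕜) : P.invT (P.T x) = x := P.T_injective (P.T_invT _)

/-! ### Sections and iterated series for the entries of `Ã`. -/

/-- The terms of the double series defining `tildeSeries`, without the factor `r k`. -/
noncomputable def tildeTerm (a : ℕ → 𝕜) (k i l : ℕ) : 𝕜 :=
  (-1) ^ i * (P.D i / P.t (k + i)) * ((-P.v) ^ l / P.u ^ (l + 1) * a (k + i + l))

theorem sum_Icc_eq_sum_range (f : ℕ → 𝕜) (i N : ℕ) :
    ∑ j ∈ Finset.Icc i N, f j = ∑ l ∈ Finset.range (N + 1 - i), f (i + l) := by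
  rw [← Finset.Ico_add_one_right_eq_Icc, Finset.sum_Ico_eq_sum_range]

/-- The three pieces of the section tile the triangle `i + l ≤ M + 1`: the corner `(0, 0)`, the rest
of row `0` with row `1`, and the rows from `2` on. The corner fits because `D 0 = 1 / s 0`. -/
theorem tildeSection_eq_sum_tildeTerm (a : ℕ → 𝕜) (k M : ℕ) :
    P.tildeSection a k (k + 1 + M) = P.r k * ∑ i ∈ Finset.range (M + 2),
      ∑ l ∈ Finset.range (M + 2 - i), P.tildeTerm a k i l := by
  rw [tildeSection, Finset.sum_range_succ', Finset.sum_range_succ']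
  simp only [sum_Icc_eq_sum_range]
  rw [show k + 1 + 1 - k = 2 by omega, Finset.sum_range_succ, Finset.sum_range_one,
    show k + 1 + M + 1 - (k + 2) = M by omega, show k + 1 + M + 1 - (k + 1) = M + 1 by omega]
  have h0 : ∑ l ∈ Finset.range (M + 2 - 0), P.tildeTerm a k 0 l =
      a k / (P.s 0 * P.t k) * (1 / P.u) + (-1) ^ 0 * (P.D 0 / P.t k) *
        ∑ x ∈ Finset.range (M + 1), (-P.v) ^ (k + 1 + x - k) / P.u ^ (k + 1 + x - k + 1) *
          a (k + 1 + x) := by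
    rw [Nat.sub_zero, Finset.sum_range_succ', add_comm, Finset.mul_sum]
    congr 1
    · simp [tildeTerm, D]
      ring
    · refine Finset.sum_congr rfl fun l _ => ?_
      rw [tildeTerm, show k + 1 + l - k = l + 1 by omega, show k + 0 + (l + 1) = k + 1 + l by omega]
      simp
  have h1 : ∑ l ∈ Finset.range (M + 2 - (0 + 1)), P.tildeTerm a k (0 + 1) l =
      (-1) ^ 1 * (P.D 1 / P.t (k + 1)) *
        ∑ x ∈ Finset.range (M + 1), (-P.v) ^ (k + 1 + x - (k + 1)) /
          P.u ^ (k + 1 + x - (k + 1) + 1) * a (k + 1 + x) := by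
    rw [zero_add, show M + 2 - 1 = M + 1 by omega, Finset.mul_sum]
    refine Finset.sum_congr rfl fun l _ => ?_
    rw [tildeTerm, Nat.add_sub_cancel_left]
  have h2 : ∀ i ∈ Finset.range M,
      ∑ l ∈ Finset.range (M + 2 - (i + 1 + 1)), P.tildeTerm a k (i + 1 + 1) l =
      (-1) ^ (k + 2 + i - k) * (P.D (k + 2 + i - k) / P.t (k + 2 + i)) *
        ∑ x ∈ Finset.range (k + 1 + M + 1 - (k + 2 + i)),
          (-P.v) ^ (k + 2 + i + x - (k + 2 + i)) / P.u ^ (k + 2 + i + x - (k + 2 + i) + 1) *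
            a (k + 2 + i + x) := by
    intro i _
    rw [show M + 2 - (i + 1 + 1) = M - i by omega, Finset.mul_sum,
      show k + 1 + M + 1 - (k + 2 + i) = M - i by omega, show k + 2 + i - k = i + 1 + 1 by omega]
    refine Finset.sum_congr rfl fun l _ => ?_
    rw [tildeTerm, Nat.add_sub_cancel_left, show k + (i + 1 + 1) = k + 2 + i by omega]
  rw [Finset.sum_congr rfl h2, h0, h1]
  simp only [add_zero, Nat.sub_self, Nat.add_sub_cancel_left]
  ring

/-- On the antidiagonal `i + l = d` the factor `a (k + d)` is constant and the remaining sum is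
`basis k (k + d)`. -/
theorem tildeSection_eq_sum_basis (a : ℕ → 𝕜) (k M : ℕ) :
    P.tildeSection a k (k + 1 + M) =
      ∑ j ∈ Finset.range (k + 1 + M + 1), a j * P.basis k j := by
  rw [tildeSection_eq_sum_tildeTerm, ← Finset.sum_range_diag_flip,
    show k + 1 + M + 1 = k + (M + 2) by omega, Finset.sum_range_add _ k,
    Finset.sum_eq_zero (s := Finset.range k), zero_add, Finset.mul_sum]
  · refine Finset.sum_congr rfl fun d _ => ?_
    rw [basis_add, Finset.mul_sum, Finset.mul_sum, Finset.mul_sum]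
    refine Finset.sum_congr rfl fun i hi => ?_
    have := Finset.mem_range.1 hi
    rw [tildeTerm, invCoeff_eq, show k + i + (d - i) = k + d by omega]
    ring
  · intro j hj
    rw [P.basis_of_lt (Finset.mem_range.1 hj), mul_zero]

theorem tendsto_tildeSection {a : ℕ → 𝕜} {k : ℕ} {y : 𝕜}
    (h : Tendsto (fun N => ∑ j ∈ Finset.range N, a j * P.basis k j) atTop (𝓝 y)) :
    Tendsto (P.tildeSection a k) atTop (𝓝 y) := by
  refine (h.comp (tendsto_add_atTop_nat 1)).congr' ?_
  filter_upwards [eventually_ge_atTop (k + 1)] with N hN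
  obtain ⟨M, rfl⟩ := Nat.exists_eq_add_of_le hN
  exact (P.tildeSection_eq_sum_basis a k M).symm

theorem tildeSeries_eq_tsum {a : ℕ → 𝕜} {k : ℕ}
    (h : Summable fun q : ℕ × ℕ => P.tildeTerm a k q.1 q.2) :
    P.tildeSeries a k = P.r k * ∑' q : ℕ × ℕ, P.tildeTerm a k q.1 q.2 := by
  rw [h.tsum_prod, h.prod.tsum_eq_zero_add, ((summable_nat_add_iff 1).2 h.prod).tsum_eq_zero_add,
    (h.prod_factor 0).tsum_eq_zero_add, tildeSeries, sum_Icc_eq_sum_range,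
    show k + 1 + 1 - k = 2 by omega, Finset.sum_range_succ, Finset.sum_range_one]
  have h0 : P.tildeTerm a k 0 0 = a k / (P.s 0 * P.t k) * (1 / P.u) := by
    simp [tildeTerm, D]
    ring
  have h1 : ∑' l, P.tildeTerm a k 0 (l + 1) = (-1) ^ (k + 0 - k) * (P.D (k + 0 - k) / P.t (k + 0)) *
      ∑' m : ℕ, (-P.v) ^ (k + 1 + m - (k + 0)) / P.u ^ (k + 1 + m - (k + 0) + 1) *
        a (k + 1 + m) := by
    rw [← tsum_mul_left]
    refine tsum_congr fun l => ?_
    rw [tildeTerm, show k + 1 + l - (k + 0) = l + 1 by omega,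
      show k + 0 + (l + 1) = k + 1 + l by omega, Nat.add_sub_cancel_left]
  have h2 : ∑' l, P.tildeTerm a k (0 + 1) l =
      (-1) ^ (k + 1 - k) * (P.D (k + 1 - k) / P.t (k + 1)) *
      ∑' m : ℕ, (-P.v) ^ (k + 1 + m - (k + 1)) / P.u ^ (k + 1 + m - (k + 1) + 1) *
        a (k + 1 + m) := by
    rw [← tsum_mul_left]
    refine tsum_congr fun l => ?_
    rw [tildeTerm, Nat.add_sub_cancel_left, Nat.add_sub_cancel_left]
  have h3 : ∑' i, ∑' l, P.tildeTerm a k (i + 1 + 1) l =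
      ∑' l : ℕ, (-1) ^ (l + 2) * (P.D (l + 2) / P.t (k + 2 + l)) *
          ∑' m : ℕ, (-P.v) ^ m / P.u ^ (m + 1) * a (k + 2 + l + m) := by
    refine tsum_congr fun i => ?_
    rw [← tsum_mul_left]
    refine tsum_congr fun l => ?_
    rw [tildeTerm, show k + (i + 1 + 1) = k + 2 + i by omega]
  rw [h0, h1, h2, h3]
  ring

theorem tendsto_tildeSection_tildeSeries {a : ℕ → 𝕜} {k : ℕ} (h : P.TildeAbsConv a k) :
    Tendsto (P.tildeSection a k) atTop (𝓝 (P.tildeSeries a k)) := by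
  have hs : Summable fun q : ℕ × ℕ => P.tildeTerm a k q.1 q.2 := by
    refine Summable.of_norm (h.congr fun q => ?_)
    simp only [tildeTerm, norm_mul, norm_pow, norm_neg, norm_one, one_pow, one_mul]
  rw [P.tildeSeries_eq_tsum hs]
  -- Absolute convergence permits regrouping by antidiagonals, whose partial sums are the triangular
  -- sections.
  have h1 := (Finset.HasAntidiagonal.sigmaAntidiagonalEquivProd (A := ℕ)).hasSum_iff.2 hs.hasSum
  have h2 := (h1.sigma fun d => hasSum_fintype _).tendsto_sum_nat.const_mul (P.r k)
  refine (h2.comp (tendsto_sub_atTop_nat k |>.comp (tendsto_add_atTop_nat 1))).congr' ?_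
  filter_upwards [eventually_ge_atTop (k + 1)] with N hN
  obtain ⟨M, rfl⟩ := Nat.exists_eq_add_of_le hN
  rw [tildeSection_eq_sum_tildeTerm, ← Finset.sum_range_diag_flip]
  simp only [Function.comp_apply]
  rw [show k + 1 + M + 1 - k = M + 2 by omega]
  congr 1
  refine Finset.sum_congr rfl fun d _ => ?_
  rw [← Finset.Nat.sum_antidiagonal_eq_sum_range_succ (P.tildeTerm a k),
    ← Finset.sum_coe_sort (Finset.HasAntidiagonal.antidiagonal d)]
  rfl

end GenMeanData

/-! ### Truncation operators on `l_p`. -/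

section lpTail

variable {𝕜 : Type*} [RCLike 𝕜] {p : ℝ≥0∞} [Fact (1 ≤ p)]

variable (𝕜 p) in
/-- The truncation of a sequence in `l_p` to the coordinates `0, …, m`. -/
noncomputable def lpHead (m : ℕ) : lp (fun _ : ℕ => 𝕜) p →L[𝕜] lp (fun _ : ℕ => 𝕜) p :=
  ∑ i ∈ Finset.range (m + 1), (lp.singleContinuousLinearMap 𝕜 (fun _ : ℕ => 𝕜) p i).comp
    (lp.evalCLM 𝕜 (fun _ : ℕ => 𝕜) p i)

theorem lpHead_apply (m : ℕ) (y : lp (fun _ : ℕ => 𝕜) p) :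
    lpHead 𝕜 p m y = ∑ i ∈ Finset.range (m + 1), lp.single p i (y i) := by
  simp only [lpHead, sum_apply]
  rfl

variable (𝕜 p) in
/-- The operator on `l_p` replacing the coordinates `0, …, m` by `0`. -/
noncomputable def lpTail (m : ℕ) : lp (fun _ : ℕ => 𝕜) p →L[𝕜] lp (fun _ : ℕ => 𝕜) p :=
  ContinuousLinearMap.id 𝕜 _ - lpHead 𝕜 p m

theorem lpTail_apply (m : ℕ) (y : lp (fun _ : ℕ => 𝕜) p) :
    lpTail 𝕜 p m y = y - lpHead 𝕜 p m y := rfl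

theorem norm_lpTail_rpow (hp : p ≠ ∞) (m : ℕ) (y : lp (fun _ : ℕ => 𝕜) p) :
    ‖lpTail 𝕜 p m y‖ ^ p.toReal = ∑' n, ‖y (m + 1 + n)‖ ^ p.toReal := by
  have hp0 : 0 < p.toReal := ENNReal.toReal_pos (zero_lt_one.trans_le Fact.out).ne' hp
  have hs := lp.hasSum_norm hp0 y
  rw [lpTail_apply, lpHead_apply, lp.norm_compl_sum_single hp0, ← hs.tsum_eq,
    ← hs.summable.sum_add_tsum_nat_add (m + 1), add_sub_cancel_left]
  exact tsum_congr fun n => by rw [add_comm]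

theorem enorm_lpTail (hp : p ≠ ∞) (m : ℕ) (y : lp (fun _ : ℕ => 𝕜) p) :
    ‖lpTail 𝕜 p m y‖ₑ = (∑' n, ‖y (m + 1 + n)‖ₑ ^ p.toReal) ^ (1 / p.toReal) := by
  have hp0 : 0 < p.toReal := ENNReal.toReal_pos (zero_lt_one.trans_le Fact.out).ne' hp
  have hs : Summable fun n => ‖y (m + 1 + n)‖ ^ p.toReal :=
    (lp.hasSum_norm hp0 y).summable.comp_injective (add_right_injective (m + 1))
  have h : ∀ n, ‖y (m + 1 + n)‖ₑ ^ p.toReal = ENNReal.ofReal (‖y (m + 1 + n)‖ ^ p.toReal) := by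
    intro n
    rw [← ofReal_norm, ENNReal.ofReal_rpow_of_nonneg (norm_nonneg _) hp0.le]
  simp only [h]
  rw [← ENNReal.ofReal_tsum_of_nonneg (fun n => by positivity) hs, ← norm_lpTail_rpow hp,
    ← ENNReal.ofReal_rpow_of_nonneg (norm_nonneg _) hp0.le, ofReal_norm, one_div,
    ENNReal.rpow_rpow_inv hp0.ne']

theorem norm_lpTail_le (hp : p ≠ ∞) (m : ℕ) (y : lp (fun _ : ℕ => 𝕜) p) :
    ‖lpTail 𝕜 p m y‖ ≤ ‖y‖ := by
  have hp0 : 0 < p.toReal := ENNReal.toReal_pos (zero_lt_one.trans_le Fact.out).ne' hp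
  refine (Real.rpow_le_rpow_iff (norm_nonneg _) (norm_nonneg _) hp0).1 ?_
  rw [lpTail_apply, lpHead_apply, lp.norm_compl_sum_single hp0]
  have : 0 ≤ ∑ i ∈ Finset.range (m + 1), ‖y i‖ ^ p.toReal :=
    Finset.sum_nonneg fun i _ => by positivity
  linarith

theorem norm_lpTail_antitone (hp : p ≠ ∞) (y : lp (fun _ : ℕ => 𝕜) p) :
    Antitone fun m => ‖lpTail 𝕜 p m y‖ := by
  have hp0 : 0 < p.toReal := ENNReal.toReal_pos (zero_lt_one.trans_le Fact.out).ne' hp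
  intro m n hmn
  refine (Real.rpow_le_rpow_iff (norm_nonneg _) (norm_nonneg _) hp0).1 ?_
  simp only [lpTail_apply, lpHead_apply, lp.norm_compl_sum_single hp0]
  have := Finset.sum_le_sum_of_subset_of_nonneg (f := fun i => ‖y i‖ ^ p.toReal)
    (Finset.range_mono (by omega : m + 1 ≤ n + 1)) (fun i _ _ => by positivity)
  linarith

theorem tendsto_norm_lpTail (hp : p ≠ ∞) (y : lp (fun _ : ℕ => 𝕜) p) :
    Tendsto (fun m => ‖lpTail 𝕜 p m y‖) atTop (𝓝 0) := by
  have h := ((lp.hasSum_single hp y).tendsto_sum_nat.comp (tendsto_add_atTop_nat 1)).const_sub y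
  rw [sub_self] at h
  simpa only [lpTail_apply, lpHead_apply, norm_zero] using! h.norm

/-- The truncation factors through the finite-dimensional space `Fin (m + 1) → 𝕜`, where bounded
sets are totally bounded. -/
theorem totallyBounded_lpHead_image (m : ℕ) {Q : Set (lp (fun _ : ℕ => 𝕜) p)}
    (hQ : Bornology.IsBounded Q) : TotallyBounded (lpHead 𝕜 p m '' Q) := by
  rw [show lpHead 𝕜 p m '' Q = (fun y => ∑ i ∈ Finset.range (m + 1), lp.single p i (y i)) '' Q from
    Set.image_congr fun y _ => lpHead_apply m y]
  let ev : lp (fun _ : ℕ => 𝕜) p →L[𝕜] (Fin (m + 1) → 𝕜) :=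
    ContinuousLinearMap.pi fun i => lp.evalCLM 𝕜 (fun _ : ℕ => 𝕜) p (i : ℕ)
  let J : (Fin (m + 1) → 𝕜) →L[𝕜] lp (fun _ : ℕ => 𝕜) p :=
    ∑ i : Fin (m + 1), (lp.singleContinuousLinearMap 𝕜 (fun _ : ℕ => 𝕜) p i).comp
      (ContinuousLinearMap.proj i)
  have h : (fun y : lp (fun _ : ℕ => 𝕜) p =>
      ∑ i ∈ Finset.range (m + 1), lp.single (E := fun _ : ℕ => 𝕜) p i (y i)) = J ∘ ev := by
    funext y
    rw [Finset.sum_range]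
    simp only [J, ev, Function.comp_apply, sum_apply]
    rfl
  rw [h, Set.image_comp]
  refine TotallyBounded.image ?_ J.uniformContinuous
  have hb : Bornology.IsBounded (ev '' Q) := ev.lipschitz.isBounded_image hQ
  exact hb.isCompact_closure.totallyBounded.subset subset_closure

end lpTail

/-! ### Measures of noncompactness and tails. -/

section hausdorffMNC

theorem hausdorffMNC_set_nonempty {X : Type*} [PseudoMetricSpace X] [Nonempty X] {Q : Set X}
    (hQ : Bornology.IsBounded Q) : {ε : ℝ | 0 < ε ∧ ∃ (n : ℕ) (x : Fin (n + 1) → X)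
      (ρ : Fin (n + 1) → ℝ), (∀ i, 0 < ρ i ∧ ρ i < ε) ∧
        Q ⊆ ⋃ i, Metric.ball (x i) (ρ i)}.Nonempty := by
  obtain ⟨c⟩ := ‹Nonempty X›
  obtain ⟨R, hR, hQR⟩ := hQ.subset_ball_lt 0 c
  refine ⟨R + 1, by positivity, 0, fun _ => c, fun _ => R, fun _ => ⟨hR, by linarith⟩, ?_⟩
  exact fun y hy => Set.mem_iUnion.2 ⟨0, hQR hy⟩

theorem hausdorffMNC_set_bddBelow {X : Type*} [PseudoMetricSpace X] (Q : Set X) :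
    BddBelow {ε : ℝ | 0 < ε ∧ ∃ (n : ℕ) (x : Fin (n + 1) → X)
      (ρ : Fin (n + 1) → ℝ), (∀ i, 0 < ρ i ∧ ρ i < ε) ∧
        Q ⊆ ⋃ i, Metric.ball (x i) (ρ i)} :=
  ⟨0, fun _ h => h.1.le⟩

/-- Lets later estimates use a finite net with non-strict distances; the strict inequalities on the
radii are absorbed by radius `R + δ / 2` below `R + δ`. -/
theorem hausdorffMNC_le_of_subset {X : Type*} [PseudoMetricSpace X] [Nonempty X] {Q s : Set X} {R : ℝ}
    (hs : s.Finite) (hR : 0 ≤ R) (h : ∀ y ∈ Q, ∃ c ∈ s, dist y c ≤ R) : hausdorffMNC Q ≤ R := by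
  rcases Q.eq_empty_or_nonempty with rfl | ⟨y₀, hy₀⟩
  · refine le_of_forall_pos_le_add fun δ hδ => csInf_le (hausdorffMNC_set_bddBelow _) ?_
    exact ⟨by positivity, 0, fun _ => Classical.arbitrary X, fun _ => δ / 2,
      fun _ => ⟨by positivity, by linarith⟩, by simp⟩
  obtain ⟨c₀, hc₀, -⟩ := h y₀ hy₀
  have : Finite s := hs
  have : Nonempty s := ⟨⟨c₀, hc₀⟩⟩
  obtain ⟨n, ⟨e⟩⟩ := Finite.exists_equiv_fin s
  obtain ⟨n, rfl⟩ : ∃ k, n = k + 1 := by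
    refine Nat.exists_eq_succ_of_ne_zero ?_
    rintro rfl
    exact (e ⟨c₀, hc₀⟩).elim0
  refine le_of_forall_pos_le_add fun δ hδ => csInf_le (hausdorffMNC_set_bddBelow _) ?_
  refine ⟨by positivity, n, fun i => e.symm i, fun _ => R + δ / 2,
    fun _ => ⟨by positivity, by linarith⟩, fun y hy => ?_⟩
  obtain ⟨c, hc, hyc⟩ := h y hy
  refine Set.mem_iUnion.2 ⟨e ⟨c, hc⟩, ?_⟩
  simp only [Equiv.symm_apply_apply, Metric.mem_ball]
  linarith

theorem hausdorffMNC_nonneg {X : Type*} [PseudoMetricSpace X] (Q : Set X) :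
    0 ≤ hausdorffMNC Q :=
  Real.sInf_nonneg fun _ h => h.1.le

theorem hausdorffMNC_sphere_le_one {E : Type*} [SeminormedAddCommGroup E] :
    hausdorffMNC (Metric.sphere (0 : E) 1) ≤ 1 :=
  hausdorffMNC_le_of_subset (Set.finite_singleton 0) zero_le_one
    fun _ hy => ⟨0, rfl, (Metric.mem_sphere.1 hy).le⟩

variable {𝕜 : Type*} [RCLike 𝕜] {p : ℝ≥0∞} [Fact (1 ≤ p)]
  {E : Type*} [NormedAddCommGroup E] [NormedSpace 𝕜 E]

theorem hausdorffMNC_image_le_mul (L : E →L[𝕜] lp (fun _ : ℕ => 𝕜) p) {c : ℝ} (hc : 0 ≤ c)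
    (hL : ∀ δ > 0, ∃ m, ∀ x, ‖lpTail 𝕜 p m (L x)‖ ≤ (c + δ) * ‖x‖) {Q : Set E}
    (hQ : Bornology.IsBounded Q) : hausdorffMNC (L '' Q) ≤ c * hausdorffMNC Q := by
  have key : ∀ ε ∈ {ε : ℝ | 0 < ε ∧ ∃ (n : ℕ) (x : Fin (n + 1) → E)
      (ρ : Fin (n + 1) → ℝ), (∀ i, 0 < ρ i ∧ ρ i < ε) ∧
        Q ⊆ ⋃ i, Metric.ball (x i) (ρ i)}, hausdorffMNC (L '' Q) ≤ c * ε := by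
    rintro ε ⟨hε, n, x, ρ, hρ, hcov⟩
    refine le_of_forall_pos_le_add fun δ hδ => ?_
    obtain ⟨m, hm⟩ := hL (δ / (2 * ε)) (by positivity)
    obtain ⟨t, ht, hcov'⟩ := Metric.totallyBounded_iff.1
      (totallyBounded_lpHead_image m (L.lipschitz.isBounded_image hQ)) (δ / 2) (by positivity)
    refine hausdorffMNC_le_of_subset (s := Set.image2 (fun a i => a + lpTail 𝕜 p m (L (x i)))
      t Set.univ) (ht.image2 _ Set.finite_univ) (by positivity) ?_
    rintro _ ⟨y, hy, rfl⟩
    obtain ⟨i, hi⟩ := Set.mem_iUnion.1 (hcov hy)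
    obtain ⟨a, ha, hya⟩ := Set.mem_iUnion₂.1
      (hcov' (Set.mem_image_of_mem _ (Set.mem_image_of_mem L hy)))
    refine ⟨_, Set.mem_image2_of_mem ha (Set.mem_univ i), ?_⟩
    have h1 : L y - (a + lpTail 𝕜 p m (L (x i))) =
        (lpHead 𝕜 p m (L y) - a) + lpTail 𝕜 p m (L (y - x i)) := by
      rw [map_sub, map_sub, lpTail_apply m (L y)]
      abel
    rw [Metric.mem_ball, dist_eq_norm] at hi hya
    rw [dist_eq_norm, h1]
    have h2 : ‖y - x i‖ ≤ ε := (hi.trans (hρ i).2).le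
    have h3 : (c + δ / (2 * ε)) * ‖y - x i‖ ≤ (c + δ / (2 * ε)) * ε := by gcongr
    have h4 : (c + δ / (2 * ε)) * ε = c * ε + δ / 2 := by field_simp
    linarith [norm_add_le (lpHead 𝕜 p m (L y) - a) (lpTail 𝕜 p m (L (y - x i))), hm (y - x i)]
  refine le_of_forall_pos_le_add fun δ hδ => ?_
  -- Dividing by `c + 1` rather than `c` covers `c = 0`.
  obtain ⟨ε, hε, hlt⟩ := exists_lt_of_csInf_lt (hausdorffMNC_set_nonempty hQ)
    (lt_add_of_pos_right (hausdorffMNC Q) (show 0 < δ / (c + 1) by positivity))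
  refine (key ε hε).trans ?_
  have h1 : c * ε ≤ c * (hausdorffMNC Q + δ / (c + 1)) := by gcongr
  have h2 : c * (δ / (c + 1)) ≤ δ := by
    rw [mul_div_assoc', div_le_iff₀ (by positivity)]
    nlinarith
  linarith

/-- For `p < ∞` one `m` makes the tails of the finitely many centres small, and passing to tails
does not increase distances to the centres. -/
theorem exists_forall_norm_lpTail_le (hp : p ≠ ∞) {Q : Set (lp (fun _ : ℕ => 𝕜) p)}
    (hQ : Bornology.IsBounded Q) {δ : ℝ} (hδ : 0 < δ) :
    ∃ m, ∀ y ∈ Q, ‖lpTail 𝕜 p m y‖ ≤ hausdorffMNC Q + δ := by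
  obtain ⟨ε, ⟨hε, n, x, ρ, hρ, hcov⟩, hlt⟩ := exists_lt_of_csInf_lt (hausdorffMNC_set_nonempty hQ)
    (lt_add_of_pos_right (hausdorffMNC Q) (show 0 < δ / 2 by positivity))
  have h : ∀ᶠ m in atTop, ∀ i, ‖lpTail 𝕜 p m (x i)‖ < δ / 2 :=
    eventually_all.2 fun i => (tendsto_norm_lpTail hp (x i)).eventually_lt_const (by positivity)
  obtain ⟨m, hm⟩ := h.exists
  refine ⟨m, fun y hy => ?_⟩
  obtain ⟨i, hi⟩ := Set.mem_iUnion.1 (hcov hy)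
  rw [Metric.mem_ball, dist_eq_norm] at hi
  have h1 : lpTail 𝕜 p m y = lpTail 𝕜 p m (y - x i) + lpTail 𝕜 p m (x i) := by
    rw [← map_add, sub_add_cancel]
  rw [h1]
  change ε < hausdorffMNC Q + δ / 2 at hlt
  linarith [norm_add_le (lpTail 𝕜 p m (y - x i)) (lpTail 𝕜 p m (x i)), hm i, (hρ i).2,
    norm_lpTail_le hp m (y - x i)]

/-- The sphere tests every admissible `κ`; only `χ(S) ≤ 1` is needed, not its exact value. -/
theorem operatorMNC_eq_of_le (L : E →L[𝕜] lp (fun _ : ℕ => 𝕜) p) {c : ℝ} (hc : 0 ≤ c)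
    (hL : ∀ Q : Set E, Bornology.IsBounded Q → hausdorffMNC (L '' Q) ≤ c * hausdorffMNC Q)
    (hS : c ≤ hausdorffMNC (L '' Metric.sphere (0 : E) 1)) :
    operatorMNC L = c ∧ hausdorffMNC (L '' Metric.sphere (0 : E) 1) = c := by
  have hle : ∀ κ : ℝ, 0 ≤ κ → κ * hausdorffMNC (Metric.sphere (0 : E) 1) ≤ κ :=
    fun κ hκ => mul_le_of_le_one_right hκ hausdorffMNC_sphere_le_one
  have hmem : c ∈ {κ : ℝ | 0 ≤ κ ∧ ∀ Q : Set E, Bornology.IsBounded Q →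
      Bornology.IsBounded (L '' Q) ∧ hausdorffMNC (L '' Q) ≤ κ * hausdorffMNC Q} :=
    ⟨hc, fun Q hQ => ⟨L.lipschitz.isBounded_image hQ, hL Q hQ⟩⟩
  refine ⟨le_antisymm (csInf_le ⟨0, fun _ h => h.1⟩ hmem) (le_csInf ⟨c, hmem⟩ fun κ hκ => ?_),
    le_antisymm ((hL _ Metric.isBounded_sphere).trans (hle c hc)) hS⟩
  exact hS.trans ((hκ.2 _ Metric.isBounded_sphere).2.trans (hle κ hκ.1))

end hausdorffMNC

/-! ### The sequence space as an isometric copy of `l_p`, and matrix maps on it. -/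

namespace GenMeanData

variable {𝕜 : Type*} [RCLike 𝕜] (P : GenMeanData 𝕜)

/-- `T` as an isometric isomorphism of `l_p(r,s,t;B)` onto `l_p`. -/
noncomputable def isometryLp (p : ℝ≥0∞) [Fact (1 ≤ p)] :
    P.Space p ≃ₗᵢ[𝕜] lp (fun _ : ℕ => 𝕜) p :=
  LinearIsometryEquiv.ofSurjective ⟨P.toLp p, fun _ => rfl⟩ fun y =>
    ⟨⟨P.invT y, show Memℓp (P.T (P.invT y)) p by rw [T_invT]; exact lp.memℓp y⟩,
      Subtype.ext (P.T_invT y)⟩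

theorem isometryLp_apply (p : ℝ≥0∞) [Fact (1 ≤ p)] (x : P.Space p) :
    (P.isometryLp p x : ℕ → 𝕜) = P.T x.seq := rfl

instance (p : ℝ≥0∞) [Fact (1 ≤ p)] : CompleteSpace (P.Space p) :=
  (completeSpace_congr (e := (P.isometryLp p).toEquiv)
    (P.isometryLp p).isometry.isUniformEmbedding).2 inferInstance

/-- The coordinate functionals of `l_p(r,s,t;B)`. -/
noncomputable def coord (p : ℝ≥0∞) [Fact (1 ≤ p)] (j : ℕ) : P.Space p →L[𝕜] 𝕜 :=
  (∑ k ∈ Finset.range (j + 1), P.basis k j • lp.evalCLM 𝕜 (fun _ : ℕ => 𝕜) p k).comp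
    (P.isometryLp p : P.Space p →L[𝕜] lp (fun _ : ℕ => 𝕜) p)

theorem coord_apply (p : ℝ≥0∞) [Fact (1 ≤ p)] (j : ℕ) (x : P.Space p) :
    P.coord p j x = x.seq j := by
  conv_rhs => rw [← P.invT_T x.seq, invT]
  simp only [coord, ContinuousLinearMap.comp_apply, sum_apply,
    smul_apply, smul_eq_mul]
  exact Finset.sum_congr rfl fun k _ => mul_comm _ _

/-- `T⁻¹ e_k` as an element of `l_p(r,s,t;B)`. -/
noncomputable def basisSpace (p : ℝ≥0∞) [Fact (1 ≤ p)] (k : ℕ) : P.Space p :=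
  (P.isometryLp p).symm (lp.single p k 1)

theorem isometryLp_basisSpace (p : ℝ≥0∞) [Fact (1 ≤ p)] (k : ℕ) :
    P.isometryLp p (P.basisSpace p k) = lp.single p k 1 :=
  (P.isometryLp p).apply_symm_apply _

theorem seq_basisSpace (p : ℝ≥0∞) [Fact (1 ≤ p)] (k : ℕ) :
    (P.basisSpace p k).seq = P.basis k := by
  apply P.T_injective
  rw [← isometryLp_apply, isometryLp_basisSpace, T_basis, lp.coeFn_single]

theorem norm_basisSpace (p : ℝ≥0∞) [Fact (1 ≤ p)] (k : ℕ) : ‖P.basisSpace p k‖ = 1 := by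
  rw [← (P.isometryLp p).norm_map, isometryLp_basisSpace,
    lp.norm_single (zero_lt_one.trans_le Fact.out), norm_one]

/-- This is where `l_1` matters: `L x` is the sum of `(T x)_k • L (T⁻¹ e_k)`, and the norms of the
coefficients add up to `‖x‖`. -/
theorem norm_apply_le_of_norm_basisSpace_le {F : Type*} [NormedAddCommGroup F] [NormedSpace 𝕜 F]
    (L : P.Space 1 →L[𝕜] F) {M : ℝ} (hM : ∀ k, ‖L (P.basisSpace 1 k)‖ ≤ M) (x : P.Space 1) :
    ‖L x‖ ≤ M * ‖x‖ := by
  let K : lp (fun _ : ℕ => 𝕜) 1 →L[𝕜] F :=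
    L.comp ((P.isometryLp 1).symm : lp (fun _ : ℕ => 𝕜) 1 →L[𝕜] P.Space 1)
  set y := P.isometryLp 1 x with hy
  have h1 : HasSum (fun k => y k • L (P.basisSpace 1 k)) (L x) := by
    have h := (lp.hasSum_single ENNReal.one_ne_top y).mapL K
    have hx : K y = L x := by simp [K, hy]
    rw [hx] at h
    have hk : ∀ k, K (lp.single 1 k (y k)) = y k • L (P.basisSpace 1 k) := by
      intro k
      have : lp.single (E := fun _ : ℕ => 𝕜) 1 k (y k) = y k • lp.single 1 k (1 : 𝕜) := by
        rw [← lp.single_smul, smul_eq_mul, mul_one]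
      rw [this, map_smul]
      rfl
    simpa only [hk] using h
  have h2 : HasSum (fun k => ‖y k‖ * M) (‖x‖ * M) := by
    have := lp.hasSum_norm (p := 1) (by simp) y
    simp only [ENNReal.toReal_one, Real.rpow_one] at this
    rw [← (P.isometryLp 1).norm_map x]
    exact this.mul_right M
  rw [mul_comm]
  refine h1.norm_le_of_bounded h2 fun k => ?_
  rw [norm_smul]
  exact mul_le_mul_of_nonneg_left (hM k) (norm_nonneg _)

theorem exists_continuousLinearMap {p : ℝ≥0∞} [Fact (1 ≤ p)] {A : ℕ → ℕ → 𝕜}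
    (hA : A ∈ MatrixClass {x : ℕ → 𝕜 | Memℓp (P.T x) 1} {y : ℕ → 𝕜 | Memℓp y p}) :
    ∃ L : P.Space 1 →L[𝕜] lp (fun _ : ℕ => 𝕜) p,
      ∀ x : P.Space 1, IsMatrixTransform A x.seq (L x) := by
  have hA' : ∀ x : P.Space 1, ∃ y : lp (fun _ : ℕ => 𝕜) p, IsMatrixTransform A x.seq y := by
    intro x
    obtain ⟨y, hy, h⟩ := hA x.seq x.2
    exact ⟨⟨y, hy⟩, h⟩
  choose f hf using hA'
  let φ (n N : ℕ) : P.Space 1 →L[𝕜] 𝕜 := ∑ k ∈ Finset.range N, A n k • P.coord 1 k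
  have hφ : ∀ n, Tendsto (fun N x => φ n N x) atTop (𝓝 fun x => f x n) := by
    intro n
    refine tendsto_pi_nhds.2 fun x => ?_
    simpa [φ, sum_apply, coord_apply] using hf x n
  -- Banach-Steinhaus: each row is a pointwise limit of continuous functionals on a complete space.
  let ψ (n : ℕ) : P.Space 1 →L[𝕜] 𝕜 := continuousLinearMapOfTendsto (φ n) (hφ n)
  have hψ : ∀ n x, ψ n x = f x n := fun _ _ => rfl
  let g : P.Space 1 →ₗ[𝕜] lp (fun _ : ℕ => 𝕜) p :=
    { toFun := f
      map_add' := fun x y => by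
        ext n
        rw [lp.coeFn_add, Pi.add_apply, ← hψ, ← hψ, ← hψ, map_add]
      map_smul' := fun c x => by
        ext n
        rw [RingHom.id_apply, lp.coeFn_smul, Pi.smul_apply, ← hψ, ← hψ, map_smul] }
  -- The graph is closed because limits can be compared coordinate by coordinate.
  refine ⟨⟨g, g.continuous_of_seq_closed_graph fun u x y hu hy => ?_⟩, hf⟩
  ext n
  have h1 := ((lp.evalCLM 𝕜 (fun _ : ℕ => 𝕜) p n).continuous.tendsto y).comp hy
  have h2 := ((ψ n).continuous.tendsto x).comp hu
  exact tendsto_nhds_unique h1 h2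

end GenMeanData

/-! ### The main theorem. -/

theorem theorem5p3 {𝕜 : Type*} [RCLike 𝕜] (P : GenMeanData 𝕜)
    (p : ℝ≥0∞) [Fact (1 ≤ p)] (hp : p ≠ ∞) (A : ℕ → ℕ → 𝕜)
    (hA : A ∈ MatrixClass {x : ℕ → 𝕜 | Memℓp (P.T x) 1} {y : ℕ → 𝕜 | Memℓp y p}) :
    (∀ n k, Tendsto (P.tildeSection (A n) k) atTop (𝓝 (P.tilde A n k))) ∧
    (∀ n k, P.TildeAbsConv (A n) k → P.tilde A n k = P.tildeSeries (A n) k) ∧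
    ∃ L : P.Space 1 →L[𝕜] lp (fun _ : ℕ => 𝕜) p,
      (∀ x : P.Space 1, IsMatrixTransform A x.seq (L x)) ∧
      (∀ m, columnTailSup p (P.tilde A) m < ∞) ∧
      Tendsto (columnTailSup p (P.tilde A)) atTop (𝓝 (ENNReal.ofReal (operatorMNC L))) ∧
      operatorMNC L = hausdorffMNC (L '' Metric.sphere (0 : P.Space 1) 1) := by
  obtain ⟨L, hL⟩ := P.exists_continuousLinearMap hA
  have htend : ∀ n k, Tendsto (P.tildeSection (A n) k) atTop (𝓝 (L (P.basisSpace 1 k) n)) := by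
    intro n k
    have h := hL (P.basisSpace 1 k) n
    rw [P.seq_basisSpace] at h
    exact P.tendsto_tildeSection h
  have htilde : ∀ n k, P.tilde A n k = L (P.basisSpace 1 k) n := fun n k => (htend n k).limUnder_eq
  have hcol : ∀ m, columnTailSup p (P.tilde A) m =
      ⨆ k, ‖lpTail 𝕜 p m (L (P.basisSpace 1 k))‖ₑ := by
    intro m
    simp only [columnTailSup, enorm_lpTail hp, htilde]
  refine ⟨fun n k => htilde n k ▸ htend n k, fun n k h =>
    tendsto_nhds_unique (htilde n k ▸ htend n k) (P.tendsto_tildeSection_tildeSeries h),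
    L, hL, ?_⟩
  have hfin : ∀ m, columnTailSup p (P.tilde A) m < ∞ := by
    intro m
    rw [hcol]
    refine (iSup_le fun k => ?_).trans_lt (ENNReal.ofReal_lt_top (r := ‖L‖))
    rw [← ofReal_norm]
    refine ENNReal.ofReal_le_ofReal ((norm_lpTail_le hp m _).trans ?_)
    simpa [P.norm_basisSpace] using L.le_opNorm (P.basisSpace 1 k)
  have hanti : Antitone (columnTailSup p (P.tilde A)) := by
    intro m n hmn
    rw [hcol, hcol]
    refine iSup_mono fun k => ?_
    rw [← ofReal_norm, ← ofReal_norm]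
    exact ENNReal.ofReal_le_ofReal (norm_lpTail_antitone hp _ hmn)
  have hlim := tendsto_atTop_iInf hanti
  set c := ⨅ m, columnTailSup p (P.tilde A) m with hc
  have hctop : c ≠ ∞ := ((iInf_le _ 0).trans_lt (hfin 0)).ne
  have hupper : ∀ Q : Set (P.Space 1), Bornology.IsBounded Q →
      hausdorffMNC (L '' Q) ≤ c.toReal * hausdorffMNC Q := by
    intro Q hQ
    refine hausdorffMNC_image_le_mul L ENNReal.toReal_nonneg (fun δ hδ => ?_) hQ
    have hlt : c < ENNReal.ofReal (c.toReal + δ) := by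
      rw [ENNReal.lt_ofReal_iff_toReal_lt hctop]
      linarith
    obtain ⟨m, hm⟩ := (hlim.eventually_lt_const hlt).exists
    -- The column tail supremum bounds the tail operator at the unit vectors, hence everywhere.
    refine ⟨m, P.norm_apply_le_of_norm_basisSpace_le ((lpTail 𝕜 p m).comp L) fun k => ?_⟩
    rw [hcol] at hm
    have := (le_iSup (fun k => ‖lpTail 𝕜 p m (L (P.basisSpace 1 k))‖ₑ) k).trans hm.le
    rw [← ofReal_norm, ENNReal.ofReal_le_ofReal_iff (by positivity)] at this
    exact this
  have hlower : c.toReal ≤ hausdorffMNC (L '' Metric.sphere (0 : P.Space 1) 1) := by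
    refine le_of_forall_pos_le_add fun δ hδ => ?_
    obtain ⟨m, hm⟩ := exists_forall_norm_lpTail_le hp
      (L.lipschitz.isBounded_image Metric.isBounded_sphere) hδ
    refine ENNReal.toReal_le_of_le_ofReal
      (add_nonneg (hausdorffMNC_nonneg _) hδ.le) ((iInf_le _ m).trans ?_)
    rw [hcol]
    refine iSup_le fun k => ?_
    rw [← ofReal_norm]
    refine ENNReal.ofReal_le_ofReal (hm _ (Set.mem_image_of_mem L ?_))
    -- The lower bound tests `S` only at the vectors `T⁻¹ e_k`, which have norm `1`.
    rw [mem_sphere_zero_iff_norm, P.norm_basisSpace]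
  obtain ⟨h1, h2⟩ := operatorMNC_eq_of_le L ENNReal.toReal_nonneg hupper hlower
  refine ⟨hfin, ?_, h1.trans h2.symm⟩
  rw [h1, ENNReal.ofReal_toReal hctop]
  exact hlim
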